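/- Let $n\ge 2$ be an integer and let $p,q$ be real numbers with $0<q<n-1$ and $p+1>2n-1$. There is a constant $C=C(p,q,n)>0$, depending only on $p,q,n$, such that the following holds. Let $\beta\in\left(1,\frac{n}{n-1}\right]$, let $\Omega\subset\mathbb R^n$ be a bounded open set (for instance a bounded domain with smooth boundary), let $a,b,\lambda>0$, and let $h\in L^{\gamma}(\Omega)$ with $\gamma=\frac{n}{n-q-1}$ be real-valued, possibly sign-changing, with $h^+\not\equiv 0$. Let $W^{1,n}_0(\Omega)$ be the closure of $C_c^\infty(\Omega)$ in $W^{1,n}(\Omega)$, with norm $\|u\|=\left(\int_\Omega|\nabla u|^n\,dx\right)^{1/n}$. Put $m(s)=as+b$, $M(t)=\int_0^t m(s)\,ds$, $g(s)=s|s|^pe^{|s|^\beta}$, $G(t)=\int_0^t g(s)\,ds$, and $$J_{\lambda,M}(u)=\frac1n M(\|u\|^n)-\frac{\lambda}{q+1}\int_\Omega h\,|u|^{q+1}\,dx-\int_\Omega G(u)\,dx,\qquad u\in W^{1,n}_0(\Omega).$$ Let $$\mathcal N_{\lambda,M}=\left\{u\in W^{1,n}_0(\Omega):\ \langle J_{\lambda,M}'(u),u\rangle=\frac{d}{dt}\Big|_{t=1}J_{\lambda,M}(tu)=0\right\}$$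 be the Nehari manifold, $\theta_{\lambda,M}=\inf\{J_{\lambda,M}(u):u\in\mathcal N_{\lambda,M}\}$ and $k=\frac{p+2+\beta}{q+1}$. Then $J_{\lambda,M}$ is bounded below on $\mathcal N_{\lambda,M}$; it is coercive there, that is, $J_{\lambda,M}(u)\to\infty$ as $\|u\|\to\infty$ with $u\in\mathcal N_{\lambda,M}$; and $$\theta_{\lambda,M}\ \ge\ -\,C\left(\int_\Omega|h|^{\frac{k}{k-1}}\,dx\right)\lambda^{\frac{k}{k-1}}.$$ -/

import Mathlib

open MeasureTheory Set Filter Topology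
open scoped ENNReal ContDiff

namespace Kirchhoff

noncomputable section

instance factOneLe (n : ℕ) [hn : Fact (2 ≤ n)] : Fact (1 ≤ (n : ℝ≥0∞)) :=
  ⟨by exact_mod_cast le_trans one_le_two hn.out⟩

/-- The pairs `(φ, ∇φ)`, `φ` a test function in `C_c^∞(Ω)`, inside `L^r(Ω) × L^r(Ω; ℝⁿ)`. -/
def testPairs {n : ℕ} (Ω : Set (EuclideanSpace ℝ (Fin n))) (r : ℝ≥0∞) :
    Submodule ℝ (Lp ℝ r (volume.restrict Ω) ×
      Lp (EuclideanSpace ℝ (Fin n)) r (volume.restrict Ω)) where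
  carrier := {w | ∃ φ : EuclideanSpace ℝ (Fin n) → ℝ,
    ContDiff ℝ ∞ φ ∧ HasCompactSupport φ ∧ tsupport φ ⊆ Ω ∧
    w.1 =ᵐ[volume.restrict Ω] φ ∧ w.2 =ᵐ[volume.restrict Ω] gradient φ}
  zero_mem' := by
    refine ⟨0, contDiff_const, HasCompactSupport.zero, by simp, Lp.coeFn_zero _ _ _, ?_⟩
    refine (Lp.coeFn_zero _ _ _).trans (Eventually.of_forall fun x => ?_)
    simp [gradient]
  add_mem' := by
    rintro v w ⟨φ, hφ, hφc, hφs, hv1, hv2⟩ ⟨ψ, hψ, hψc, hψs, hw1, hw2⟩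
    refine ⟨φ + ψ, hφ.add hψ, hφc.add hψc,
      (tsupport_add φ ψ).trans (union_subset hφs hψs), ?_, ?_⟩
    · exact (Lp.coeFn_add v.1 w.1).trans (hv1.add hw1)
    · refine ((Lp.coeFn_add v.2 w.2).trans (hv2.add hw2)).trans
        (Eventually.of_forall fun x => ?_)
      have h1 : DifferentiableAt ℝ φ x := hφ.differentiable (by simp) x
      have h2 : DifferentiableAt ℝ ψ x := hψ.differentiable (by simp) x
      simp [gradient, fderiv_add h1 h2]
  smul_mem' := by
    rintro c w ⟨φ, hφ, hφc, hφs, hw1, hw2⟩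
    refine ⟨c • φ, hφ.const_smul c, hφc.smul_left (f := fun _ => c),
      (tsupport_smul_subset_right (fun _ => c) φ).trans hφs, ?_, ?_⟩
    · exact (Lp.coeFn_smul c w.1).trans (hw1.const_smul c)
    · refine ((Lp.coeFn_smul c w.2).trans (hw2.const_smul c)).trans
        (Eventually.of_forall fun x => ?_)
      have h1 : DifferentiableAt ℝ φ x := hφ.differentiable (by simp) x
      simp [gradient, fderiv_const_smul h1 c]

/-- The Sobolev space `W₀^{1,r}(Ω)`: the closure of `C_c^∞(Ω)` in the `W^{1,r}` topology. An element
is stored together with its weak gradient, as the pair `(u, ∇u) ∈ L^r(Ω) × L^r(Ω; ℝⁿ)`. -/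
abbrev SobolevZero {n : ℕ} (Ω : Set (EuclideanSpace ℝ (Fin n))) (r : ℝ≥0∞) [Fact (1 ≤ r)] :
    Submodule ℝ (Lp ℝ r (volume.restrict Ω) ×
      Lp (EuclideanSpace ℝ (Fin n)) r (volume.restrict Ω)) :=
  (testPairs Ω r).topologicalClosure

variable {n : ℕ} [Fact (2 ≤ n)] {Ω : Set (EuclideanSpace ℝ (Fin n))}

/-- The function underlying an element of `W₀^{1,n}(Ω)`. -/
def val (u : SobolevZero Ω (n : ℝ≥0∞)) : EuclideanSpace ℝ (Fin n) → ℝ := u.1.1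

/-- The weak gradient of an element of `W₀^{1,n}(Ω)`. -/
def grad (u : SobolevZero Ω (n : ℝ≥0∞)) : EuclideanSpace ℝ (Fin n) → EuclideanSpace ℝ (Fin n) :=
  u.1.2

/-- The norm `‖u‖ = (∫_Ω |∇u|ⁿ dx)^{1/n}` of `W₀^{1,n}(Ω)`. -/
def gradNorm (u : SobolevZero Ω (n : ℝ≥0∞)) : ℝ :=
  (∫ x in Ω, ‖grad u x‖ ^ n) ^ (1 / (n : ℝ))

/-- The Kirchhoff coefficient `m(s) = a s + b`. -/
def m (a b s : ℝ) : ℝ := a * s + b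

/-- The primitive `M(t) = ∫₀ᵗ m(s) ds`. -/
def M (a b t : ℝ) : ℝ := ∫ s in (0 : ℝ)..t, m a b s

/-- The nonlinearity `g(s) = s |s|^p e^{|s|^β}`. -/
def g (p β s : ℝ) : ℝ := s * |s| ^ p * Real.exp (|s| ^ β)

/-- The primitive `G(t) = ∫₀ᵗ g(s) ds`. -/
def G (p β t : ℝ) : ℝ := ∫ s in (0 : ℝ)..t, g p β s

/-- The energy
`J(u) = (1/n) M(‖u‖ⁿ) - λ/(q+1) ∫_Ω h |u|^{q+1} dx - ∫_Ω G(u) dx` on `W₀^{1,n}(Ω)`. -/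
def J (p q β a b lam : ℝ) (h : EuclideanSpace ℝ (Fin n) → ℝ)
    (u : SobolevZero Ω (n : ℝ≥0∞)) : ℝ :=
  1 / (n : ℝ) * M a b (gradNorm u ^ n)
    - lam / (q + 1) * (∫ x in Ω, h x * |val u x| ^ (q + 1))
    - ∫ x in Ω, G p β (val u x)

/-- The fibering map `φ_u(t) = J(t u)`. -/
def fiber (p q β a b lam : ℝ) (h : EuclideanSpace ℝ (Fin n) → ℝ)
    (u : SobolevZero Ω (n : ℝ≥0∞)) (t : ℝ) : ℝ :=
  J p q β a b lam h (t • u)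

/-- The Nehari manifold `{u ∈ W₀^{1,n}(Ω) : ⟨J'(u), u⟩ = φ_u'(1) = 0}`. -/
def nehari (Ω : Set (EuclideanSpace ℝ (Fin n))) (p q β a b lam : ℝ)
    (h : EuclideanSpace ℝ (Fin n) → ℝ) : Set (SobolevZero Ω (n : ℝ≥0∞)) :=
  {u | HasDerivAt (fiber p q β a b lam h u) 0 1}

/-- The infimum `θ` of the energy on the Nehari manifold. -/
def theta (Ω : Set (EuclideanSpace ℝ (Fin n))) (p q β a b lam : ℝ)
    (h : EuclideanSpace ℝ (Fin n) → ℝ) : ℝ :=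
  sInf (J p q β a b lam h '' nehari Ω p q β a b lam h)

end

end Kirchhoff

/-!
The energy on the Nehari manifold is bounded below because the nonlinearity is superlinear beyond
the Kirchhoff term. With `E = ‖u‖ⁿ` and `A = ∫ h |u|^(q+1)`, the Nehari equation reads
`a E² + b E = λ A + ∫ g(u) u` (`nehari_eq`). Subtracting `1 / (p + 2)` times this equation from
`J(u)` gives

  `J(u) = a (1/(2n) - 1/(p+2)) E² + b (1/n - 1/(p+2)) E - λ (1/(q+1) - 1/(p+2)) A`
  `       + ∫ (g(u) u / (p+2) - G(u))`.

Since `p + 2 > 2n`, the first two terms are nonnegative and the second one is coercive. Integrating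
`G` by parts shows that the last integrand is at least a multiple of `|u|^(p+2+β)`
(`G_add_rpow_le`), and `p + 2 + β = k (q + 1)`, so Young's inequality (`exists_young`) absorbs the
`A`-term at the price of `C λ^(k/(k-1)) ∫ |h|^(k/(k-1))`. As `1 < β ≤ 2`, the constants can be taken
independent of `β`.

All of this presupposes that the integrals are finite and that `t ↦ ∫ G(t u)` may be differentiated
under the integral sign. At the critical growth `β = n / (n - 1)` this is Trudinger's theorem:
`exp (c |u|^(n/(n-1)))` is integrable for all `u ∈ W₀^{1,n}(Ω)` and all `c`
(`lintegral_exp_val_ne_top`). It is proved here by slicing a test function between consecutive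
levels. Applying the `L¹` Gagliardo–Nirenberg–Sobolev inequality to a smooth truncation of `u`
between the levels `t < s` gives

  `(s - t)ⁿ |{u > s}|^(n-1) ≤ K (∫_{t < u < s} |∇u|ⁿ) |{u > t}|^(n-1)`

(`exists_measure_superlevel_le`). Over `N` equal steps up to the level `T` the energies of the
slabs add up to at most `‖∇u‖ₙⁿ`, so by the inequality of arithmetic and geometric means
`|{u > T}|^(n-1) ≤ |Ω|^(n-1) (K ‖∇u‖ₙⁿ N^(n-1) / Tⁿ)^N`, and `T` proportional to `N^((n-1)/n)` yields
the tail `exp (-c T^(n/(n-1)))` (`exists_measure_superlevel_le_exp`). Density of test functions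
and Fatou's lemma carry the estimate over to `W₀^{1,n}(Ω)`.
-/

namespace Kirchhoff

/-! ### Superlevel sets of test functions -/

lemma lintegral_pow_le_lintegral_pow_mul_measure {α : Type*} [MeasurableSpace α] {μ : Measure α}
    {n : ℕ} (hn : 2 ≤ n) {f : α → ℝ≥0∞} (hf : AEMeasurable f μ) :
    (∫⁻ x, f x ∂μ) ^ n ≤ (∫⁻ x, f x ^ n ∂μ) * μ univ ^ (n - 1) := by
  have hn1 : (1 : ℝ) < n := by exact_mod_cast hn
  have hpq : (n : ℝ).HolderConjugate (n / (n - 1)) := Real.HolderConjugate.conjExponent hn1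
  have h := ENNReal.lintegral_mul_le_Lp_mul_Lq μ hpq hf (aemeasurable_const (b := (1 : ℝ≥0∞)))
  simp only [Pi.mul_apply, mul_one, ENNReal.one_rpow, lintegral_const, one_mul,
    ENNReal.rpow_natCast] at h
  calc (∫⁻ x, f x ∂μ) ^ n
      ≤ ((∫⁻ x, f x ^ n ∂μ) ^ (1 / (n : ℝ)) * μ univ ^ (1 / ((n : ℝ) / (n - 1)))) ^ n := by gcongr
    _ = (∫⁻ x, f x ^ n ∂μ) * μ univ ^ (n - 1) := by
      rw [mul_pow, ← ENNReal.rpow_natCast, ← ENNReal.rpow_natCast, ← ENNReal.rpow_natCast,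
        ← ENNReal.rpow_mul, ← ENNReal.rpow_mul]
      have h0 : (n : ℝ) ≠ 0 := by positivity
      congr 1
      · rw [one_div_mul_cancel h0, ENNReal.rpow_one]
      · congr 1
        rw [Nat.cast_sub (by omega)]
        field_simp
        simp

/-- The derivative of the smooth step is bounded and vanishes off the open interval `(0, 1)`, even at
its end points, which makes the slabs between consecutive levels disjoint. -/
lemma exists_abs_deriv_smoothTransition_le :
    ∃ L : ℝ, 0 < L ∧ ∀ x, |deriv Real.smoothTransition x| ≤ L ∧
      (x ∉ Ioo (0 : ℝ) 1 → deriv Real.smoothTransition x = 0) := by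
  have hzero : ∀ x, x ∉ Ioo (0 : ℝ) 1 → deriv Real.smoothTransition x = 0 := by
    intro x hx
    rcases le_or_gt x 0 with h | h
    · refine IsLocalMin.deriv_eq_zero (Eventually.of_forall fun y => ?_)
      rw [Real.smoothTransition.zero_of_nonpos h]
      exact Real.smoothTransition.nonneg y
    · have h1 : 1 ≤ x := by
        by_contra hc
        exact hx ⟨h, not_le.1 hc⟩
      refine IsLocalMax.deriv_eq_zero (Eventually.of_forall fun y => ?_)
      rw [Real.smoothTransition.one_of_one_le h1]
      exact Real.smoothTransition.le_one y
  have hc : Continuous (deriv Real.smoothTransition) :=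
    (Real.smoothTransition.contDiff (n := 1)).continuous_deriv (by simp)
  obtain ⟨L, hL⟩ := (isCompact_Icc (a := (0 : ℝ)) (b := 1)).exists_bound_of_continuousOn
    hc.continuousOn
  refine ⟨max L 1, by positivity, fun x => ⟨?_, hzero x⟩⟩
  by_cases hx : x ∈ Ioo (0 : ℝ) 1
  · exact (hL x (Ioo_subset_Icc_self hx)).trans (le_max_left _ _)
  · rw [hzero x hx]
    simp

lemma enorm_fderiv_smoothTransition_comp_le {E : Type*} [NormedAddCommGroup E] [NormedSpace ℝ E]
    {L : ℝ} (hL : ∀ x, |deriv Real.smoothTransition x| ≤ L ∧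
      (x ∉ Ioo (0 : ℝ) 1 → deriv Real.smoothTransition x = 0))
    {u : E → ℝ} (hu : Differentiable ℝ u) {s t : ℝ} (hts : t < s) (x : E) :
    ‖fderiv ℝ (fun x => Real.smoothTransition ((u x - t) / (s - t))) x‖ₑ ≤
      ENNReal.ofReal (L / (s - t)) * (u ⁻¹' Ioo t s).indicator (fun x => ‖fderiv ℝ u x‖ₑ) x := by
  have hst : 0 < s - t := sub_pos.2 hts
  have h1 : HasFDerivAt (fun x => (u x - t) / (s - t)) ((s - t)⁻¹ • fderiv ℝ u x) x := by
    have := ((hu x).hasFDerivAt.sub_const t).const_smul ((s - t)⁻¹)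
    refine this.congr_of_eventuallyEq (Eventually.of_forall fun y => ?_)
    simp [div_eq_inv_mul]
  have h2 : HasDerivAt Real.smoothTransition (deriv Real.smoothTransition ((u x - t) / (s - t)))
      ((u x - t) / (s - t)) :=
    ((Real.smoothTransition.contDiff (n := 1)).differentiable (by simp) _).hasDerivAt
  have h3 := h2.comp_hasFDerivAt x h1
  have h4 : fderiv ℝ (fun x => Real.smoothTransition ((u x - t) / (s - t))) x =
    deriv Real.smoothTransition ((u x - t) / (s - t)) • (s - t)⁻¹ • fderiv ℝ u x := h3.fderiv
  rw [h4]
  by_cases hx : u x ∈ Ioo t s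
  · rw [indicator_of_mem (by exact hx), smul_smul, enorm_smul]
    gcongr
    rw [← ofReal_norm]
    apply ENNReal.ofReal_le_ofReal
    rw [Real.norm_eq_abs, abs_mul, abs_of_pos (inv_pos.2 hst), div_eq_mul_inv]
    exact mul_le_mul_of_nonneg_right (hL _).1 (inv_pos.2 hst).le
  · rw [enorm_smul, (hL _).2, enorm_zero, zero_mul]
    · exact zero_le
    · rintro ⟨ha, hb⟩
      rw [div_pos_iff_of_pos_right hst] at ha
      rw [div_lt_one hst] at hb
      exact hx ⟨by linarith, by linarith⟩

/-- The isoperimetric form of the Gagliardo–Nirenberg–Sobolev inequality: the measure of a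
superlevel set of a test function is controlled by that of a lower one, through the `n`-energy
carried by the slab in between. -/
lemma exists_measure_superlevel_le (n : ℕ) (hn : 2 ≤ n) :
    ∃ K : ℝ, 0 < K ∧ ∀ u : EuclideanSpace ℝ (Fin n) → ℝ, ContDiff ℝ 1 u → HasCompactSupport u →
      ∀ t s : ℝ, 0 ≤ t → t < s →
        (volume.real (u ⁻¹' Ioi s)) ^ (n - 1) ≤
          K / (s - t) ^ n * (∫⁻ x in u ⁻¹' Ioo t s, ‖fderiv ℝ u x‖ₑ ^ n).toReal *
            (volume.real (u ⁻¹' Ioi t)) ^ (n - 1) := by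
  obtain ⟨L, hL0, hL⟩ := exists_abs_deriv_smoothTransition_le
  have hn1 : (1 : ℝ) < n := by exact_mod_cast hn
  set p : ℝ := n / (n - 1) with hp
  have hpq : (n : ℝ).HolderConjugate p := Real.HolderConjugate.conjExponent hn1
  set C := lintegralPowLePowLIntegralFDerivConst
    (volume : Measure (EuclideanSpace ℝ (Fin n))) p with hC
  refine ⟨(C + 1) ^ (n - 1) * L ^ n, by positivity, fun u hu hcu t s ht hts => ?_⟩
  have hst : 0 < s - t := sub_pos.2 hts
  -- The truncation `v` vanishes below the level `t` and equals `1` above the level `s`.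
  set v : EuclideanSpace ℝ (Fin n) → ℝ := fun x => Real.smoothTransition ((u x - t) / (s - t))
  have hv : ContDiff ℝ 1 v :=
    (Real.smoothTransition.contDiff (n := 1)).comp ((hu.sub contDiff_const).div_const _)
  have hcv : HasCompactSupport v := by
    refine hcu.comp_left (g := fun y => Real.smoothTransition ((y - t) / (s - t))) ?_
    exact Real.smoothTransition.zero_of_nonpos (div_nonpos_of_nonpos_of_nonneg (by linarith) hst.le)
  have hgns := lintegral_pow_le_pow_lintegral_fderiv
    (volume : Measure (EuclideanSpace ℝ (Fin n))) hv hcv (p := p) (by simpa using hpq)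
  have hms : MeasurableSet (u ⁻¹' Ioi s) := hu.continuous.measurable measurableSet_Ioi
  have hmt : MeasurableSet (u ⁻¹' Ioo t s) := hu.continuous.measurable measurableSet_Ioo
  have hlow : volume (u ⁻¹' Ioi s) ≤ ∫⁻ x, ‖v x‖ₑ ^ p := by
    rw [← lintegral_indicator_one hms]
    refine lintegral_mono fun x => ?_
    by_cases hx : s < u x
    · have : v x = 1 := Real.smoothTransition.one_of_one_le (by
        rw [le_div_iff₀ hst]; linarith)
      rw [indicator_of_mem (by exact hx)]
      simp [this]
    · rw [indicator_of_notMem (by exact hx)]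
      exact zero_le
  have hfin : ∀ r : ℝ, 0 ≤ r → volume (u ⁻¹' Ioi r) ≠ ⊤ := by
    intro r hr
    refine ((measure_mono ?_).trans_lt hcu.isCompact.measure_lt_top).ne
    intro x hx
    exact subset_tsupport _ (by
      have : r < u x := hx
      simp only [Function.mem_support]; linarith)
  have hDv : (∫⁻ x, ‖fderiv ℝ v x‖ₑ) ≤
      ENNReal.ofReal (L / (s - t)) * ∫⁻ x in u ⁻¹' Ioo t s, ‖fderiv ℝ u x‖ₑ := by
    rw [← lintegral_indicator hmt, ← lintegral_const_mul' _ _ ENNReal.ofReal_ne_top]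
    exact lintegral_mono fun x =>
      enorm_fderiv_smoothTransition_comp_le hL (hu.differentiable (by simp)) hts x
  have hmeas : Measurable fun x => ‖fderiv ℝ u x‖ₑ :=
    (hu.continuous_fderiv (by simp)).enorm.measurable
  have hH := lintegral_pow_le_lintegral_pow_mul_measure
    (μ := volume.restrict (u ⁻¹' Ioo t s)) hn hmeas.aemeasurable
  have key : volume (u ⁻¹' Ioi s) ^ (n - 1) ≤
      (C : ℝ≥0∞) ^ (n - 1) * (ENNReal.ofReal (L / (s - t)) ^ n *
        ((∫⁻ x in u ⁻¹' Ioo t s, ‖fderiv ℝ u x‖ₑ ^ n) * volume (u ⁻¹' Ioi t) ^ (n - 1))) := by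
    calc volume (u ⁻¹' Ioi s) ^ (n - 1)
        ≤ (C * (∫⁻ x, ‖fderiv ℝ v x‖ₑ) ^ p) ^ (n - 1) := by
          gcongr
          exact hlow.trans hgns
      _ = (C : ℝ≥0∞) ^ (n - 1) * (∫⁻ x, ‖fderiv ℝ v x‖ₑ) ^ n := by
          rw [mul_pow, ← ENNReal.rpow_natCast (_ ^ p), ← ENNReal.rpow_mul,
            ← ENNReal.rpow_natCast _ n]
          congr 2
          rw [Nat.cast_sub (by omega), hp]
          have : (n : ℝ) - 1 ≠ 0 := by linarith
          push_cast
          field_simp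
      _ ≤ (C : ℝ≥0∞) ^ (n - 1) * (ENNReal.ofReal (L / (s - t)) ^ n *
            (∫⁻ x in u ⁻¹' Ioo t s, ‖fderiv ℝ u x‖ₑ) ^ n) := by
          rw [← mul_pow]
          gcongr
      _ ≤ _ := by
          gcongr
          refine hH.trans ?_
          rw [Measure.restrict_apply_univ]
          gcongr
          exact Ioo_subset_Ioi_self
  have hEfin : (∫⁻ x in u ⁻¹' Ioo t s, ‖fderiv ℝ u x‖ₑ ^ n) ≠ ⊤ := by
    have hcont : Continuous fun x => ‖fderiv ℝ u x‖ := (hu.continuous_fderiv (by simp)).norm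
    obtain ⟨B, hB⟩ := (hcu.fderiv ℝ).norm.exists_bound_of_continuous hcont
    refine ne_top_of_le_ne_top ?_ (setLIntegral_mono (g := fun _ => ENNReal.ofReal B ^ n)
      measurable_const (fun x _ => ?_))
    · rw [setLIntegral_const]
      refine ENNReal.mul_ne_top (by finiteness) ?_
      exact ne_top_of_le_ne_top (hfin t ht) (measure_mono (preimage_mono Ioo_subset_Ioi_self))
    · gcongr
      rw [← ofReal_norm]
      exact ENNReal.ofReal_le_ofReal (by simpa using hB x)
  have key2 := ENNReal.toReal_mono (by
    exact ENNReal.mul_ne_top (by finiteness) (ENNReal.mul_ne_top (by finiteness)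
      (ENNReal.mul_ne_top hEfin (ENNReal.pow_ne_top (hfin t ht))))) key
  simp only [ENNReal.toReal_mul, ENNReal.toReal_pow, ENNReal.coe_toReal] at key2
  rw [ENNReal.toReal_ofReal (by positivity)] at key2
  refine key2.trans ?_
  rw [div_pow]
  change (C : ℝ) ^ (n - 1) * (L ^ n / (s - t) ^ n * (_ * volume.real (u ⁻¹' Ioi t) ^ (n - 1))) ≤ _
  calc _ ≤ ((C : ℝ) + 1) ^ (n - 1) * (L ^ n / (s - t) ^ n *
        ((∫⁻ x in u ⁻¹' Ioo t s, ‖fderiv ℝ u x‖ₑ ^ n).toReal *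
          volume.real (u ⁻¹' Ioi t) ^ (n - 1))) := by
        gcongr
        linarith
    _ = _ := by ring

lemma prod_range_le_div_pow {d : ℕ → ℝ} (hd : ∀ j, 0 ≤ d j) {D : ℝ} {N : ℕ} (hN : 0 < N)
    (hD : ∑ j ∈ Finset.range N, d j ≤ D) : ∏ j ∈ Finset.range N, d j ≤ (D / N) ^ N := by
  have hN' : (0 : ℝ) < N := by exact_mod_cast hN
  have h := Real.geom_mean_le_arith_mean (Finset.range N) (fun _ => 1) d (by simp)
    (by simpa using hN) (fun j _ => hd j)
  simp only [Real.rpow_one, Finset.sum_const, Finset.card_range, nsmul_eq_mul, mul_one,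
    one_mul] at h
  have h0 : 0 ≤ ∏ j ∈ Finset.range N, d j := Finset.prod_nonneg fun j _ => hd j
  calc ∏ j ∈ Finset.range N, d j = ((∏ j ∈ Finset.range N, d j) ^ ((N : ℝ)⁻¹)) ^ N :=
        (Real.rpow_inv_natCast_pow h0 hN.ne').symm
    _ ≤ (D / N) ^ N := by
        gcongr
        exact h.trans (by gcongr)

/-- Iterating a recursion whose factors have a bounded sum: by the inequality of arithmetic and
geometric means the product is largest when the factors are equal. -/
lemma le_mul_pow_of_recursion {ν d : ℕ → ℝ} (hν : ∀ j, 0 ≤ ν j) (hd : ∀ j, 0 ≤ d j) {B D : ℝ}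
    (hB : 0 ≤ B) (hrec : ∀ j, ν (j + 1) ≤ B * d j * ν j) {N : ℕ} (hN : 0 < N)
    (hD : ∑ j ∈ Finset.range N, d j ≤ D) : ν N ≤ (B * (D / N)) ^ N * ν 0 := by
  have h : ∀ k, ν k ≤ B ^ k * (∏ j ∈ Finset.range k, d j) * ν 0 := by
    intro k
    induction k with
    | zero => simp
    | succ k ih =>
      refine (hrec k).trans ?_
      rw [Finset.prod_range_succ, pow_succ]
      have := mul_le_mul_of_nonneg_left ih (mul_nonneg hB (hd k))
      linarith
  refine (h N).trans ?_
  rw [mul_pow]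
  have := hν 0
  gcongr
  exact prod_range_le_div_pow hd hN hD

/-- Superlevel sets of a test function of small `n`-energy decay exponentially along the levels
`(A N)^(1-1/n)`. -/
lemma exists_measure_superlevel_le_exp (n : ℕ) (hn : 2 ≤ n) :
    ∃ K : ℝ, 0 < K ∧ ∀ u : EuclideanSpace ℝ (Fin n) → ℝ, ContDiff ℝ 1 u → HasCompactSupport u →
      (∫⁻ x, ‖fderiv ℝ u x‖ₑ ^ n) ≠ ⊤ →
      ∀ A : ℝ, 0 < A → K * (∫⁻ x, ‖fderiv ℝ u x‖ₑ ^ n).toReal ≤ (A * Real.exp (-2)) ^ (n - 1) →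
      ∀ N : ℕ, volume.real (u ⁻¹' Ioi ((A * N) ^ (((n : ℝ) - 1) / n))) ≤
        Real.exp (-2 * N) * volume.real (u ⁻¹' Ioi 0) := by
  obtain ⟨K, hK, hslab⟩ := exists_measure_superlevel_le n hn
  refine ⟨K, hK, fun u hu hcu hfin A hA hsmall N => ?_⟩
  have hn1 : (1 : ℝ) < n := by exact_mod_cast hn
  have hexp : ((n : ℝ) - 1) / n ≠ 0 := by
    have : (0 : ℝ) < n - 1 := by linarith
    positivity
  rcases Nat.eq_zero_or_pos N with rfl | hN
  · simp [Real.zero_rpow hexp]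
  have hN' : (0 : ℝ) < N := by exact_mod_cast hN
  set T : ℝ := (A * N) ^ (((n : ℝ) - 1) / n) with hT
  have hTpos : 0 < T := by positivity
  have hTn : T ^ n = (A * N) ^ (n - 1) := by
    rw [hT, ← Real.rpow_natCast, ← Real.rpow_mul (by positivity), ← Real.rpow_natCast]
    congr 1
    rw [Nat.cast_sub (by omega)]
    field_simp
    simp
  set h : ℝ := T / N with hh
  have hhpos : 0 < h := by positivity
  set d : ℕ → ℝ := fun j =>
    (∫⁻ x in u ⁻¹' Ioo (j * h) ((j + 1 : ℕ) * h), ‖fderiv ℝ u x‖ₑ ^ n).toReal with hd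
  have hdisj : Pairwise (Function.onFun Disjoint
      fun j : ℕ => u ⁻¹' Ioo (j * h) ((j + 1 : ℕ) * h)) := by
    intro i j hij
    refine Disjoint.preimage _ ?_
    have hmono : Monotone fun j : ℕ => (j : ℝ) * h := fun a b hab => by
      have : (a : ℝ) ≤ b := by exact_mod_cast hab
      exact mul_le_mul_of_nonneg_right this hhpos.le
    exact (hmono.pairwise_disjoint_on_Ioo_succ hij)
  have hsum : ∑ j ∈ Finset.range N, d j ≤ (∫⁻ x, ‖fderiv ℝ u x‖ₑ ^ n).toReal := by
    rw [hd, ← ENNReal.toReal_sum]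
    · refine ENNReal.toReal_mono hfin ?_
      rw [← lintegral_biUnion_finset]
      · exact setLIntegral_le_lintegral _ _
      · exact fun i _ j _ hij => hdisj hij
      · exact fun j _ => hu.continuous.measurable measurableSet_Ioo
    · exact fun j _ => ne_top_of_le_ne_top hfin (setLIntegral_le_lintegral _ _)
  have hrec := le_mul_pow_of_recursion
    (ν := fun j : ℕ => volume.real (u ⁻¹' Ioi (j * h)) ^ (n - 1)) (d := d) (B := K / h ^ n)
    (fun j => by positivity) (fun j => ENNReal.toReal_nonneg) (by positivity) (fun j => by
      have := hslab u hu hcu (j * h) ((j + 1 : ℕ) * h) (by positivity) (by push_cast; linarith)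
      have h2 : ((j + 1 : ℕ) : ℝ) * h - j * h = h := by push_cast; ring
      rwa [h2] at this) hN hsum
  simp only [Nat.cast_zero, zero_mul] at hrec
  have hNh : (N : ℝ) * h = T := by rw [hh]; field_simp
  rw [hNh] at hrec
  -- The step `T / N` is chosen so that `N * (T / N) ^ n = A ^ (n - 1)`.
  have hfac : K / h ^ n * ((∫⁻ x, ‖fderiv ℝ u x‖ₑ ^ n).toReal / N) ≤ Real.exp (-2) ^ (n - 1) := by
    have e1 : h ^ n * N = A ^ (n - 1) := by
      rw [hh, div_pow, hTn, mul_pow]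
      obtain ⟨m, rfl⟩ : ∃ m, n = m + 1 := ⟨n - 1, by omega⟩
      simp only [Nat.add_sub_cancel]
      field_simp
      rw [pow_succ]
    calc _ = K * (∫⁻ x, ‖fderiv ℝ u x‖ₑ ^ n).toReal / (h ^ n * N) := by ring
      _ ≤ _ := by
        rw [e1, div_le_iff₀ (by positivity)]
        rw [mul_pow] at hsmall
        linarith
  have hle : volume.real (u ⁻¹' Ioi T) ^ (n - 1) ≤
      (Real.exp (-2 * N) * volume.real (u ⁻¹' Ioi 0)) ^ (n - 1) := by
    refine hrec.trans ?_
    rw [mul_pow (Real.exp _), mul_comm (-2 : ℝ), Real.exp_nat_mul, pow_right_comm]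
    gcongr
  exact le_of_pow_le_pow_left₀ (by omega) (by positivity) hle

/-! ### Trudinger's inequality for test functions -/

/-- Layer decomposition of `exp (|y|^p / A)` along the levels `(A N)^(1/p)`: the term with
`N < |y|^p / A ≤ N + 1` alone bounds the left side. -/
lemma ofReal_exp_le_one_add_tsum {p A : ℝ} (hp : 1 < p) (hA : 0 < A) (y : ℝ) :
    ENNReal.ofReal (Real.exp (A⁻¹ * |y| ^ p)) ≤ 1 + ∑' N : ℕ, ENNReal.ofReal (Real.exp (N + 1)) *
      ((Ioi ((A * N) ^ p⁻¹)).indicator 1 y + (Ioi ((A * N) ^ p⁻¹)).indicator 1 (-y)) := by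
  have hp0 : 0 < p := by linarith
  rcases eq_or_ne y 0 with rfl | hy
  · rw [abs_zero, Real.zero_rpow hp0.ne', mul_zero, Real.exp_zero, ENNReal.ofReal_one]
    exact le_self_add
  set z := A⁻¹ * |y| ^ p with hz
  have hzpos : 0 < z := by positivity
  obtain ⟨N, hN⟩ : ∃ N : ℕ, ⌈z⌉₊ = N + 1 :=
    ⟨⌈z⌉₊ - 1, by have := Nat.ceil_pos.2 hzpos; omega⟩
  have h1 : z ≤ N + 1 := by
    have := Nat.le_ceil z
    rw [hN] at this
    exact_mod_cast this
  have h2 : (N : ℝ) < z := Nat.lt_ceil.1 (by omega)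
  have h3 : (A * N) ^ p⁻¹ < |y| := by
    rw [Real.rpow_inv_lt_iff_of_pos (by positivity) (abs_nonneg y) hp0]
    calc A * N < A * z := by gcongr
      _ = |y| ^ p := by rw [hz]; field_simp
  refine le_add_left ((?_ : _ ≤ _).trans (ENNReal.le_tsum N))
  have h4 : (1 : ℝ≥0∞) ≤ (Ioi ((A * N) ^ p⁻¹)).indicator 1 y +
      (Ioi ((A * N) ^ p⁻¹)).indicator 1 (-y) := by
    rcases lt_abs.1 h3 with h | h
    · rw [indicator_of_mem (show y ∈ Ioi _ from h)]
      exact le_self_add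
    · rw [indicator_of_mem (show -y ∈ Ioi _ from h)]
      exact le_add_self
  calc ENNReal.ofReal (Real.exp z) ≤ ENNReal.ofReal (Real.exp (N + 1)) * 1 := by
        rw [mul_one]
        exact ENNReal.ofReal_le_ofReal (Real.exp_le_exp.2 h1)
    _ ≤ _ := by gcongr

/-- Trudinger's inequality for test functions of small energy. -/
lemma exists_lintegral_exp_le (n : ℕ) (hn : 2 ≤ n) {c : ℝ} (hc : 0 < c) :
    ∃ ε : ℝ, 0 < ε ∧ ∃ B : ℝ≥0∞, B ≠ ⊤ ∧
      ∀ (Ω : Set (EuclideanSpace ℝ (Fin n))) (u : EuclideanSpace ℝ (Fin n) → ℝ), ContDiff ℝ 1 u →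
        HasCompactSupport u → tsupport u ⊆ Ω →
        (∫⁻ x, ‖fderiv ℝ u x‖ₑ ^ n) ≤ ENNReal.ofReal ε →
        ∫⁻ x in Ω, ENNReal.ofReal (Real.exp (c * |u x| ^ ((n : ℝ) / (n - 1)))) ≤
          B * volume Ω := by
  obtain ⟨K, hK, hdecay⟩ := exists_measure_superlevel_le_exp n hn
  have hn1 : (1 : ℝ) < n := by exact_mod_cast hn
  set p : ℝ := n / (n - 1) with hp
  have hp1 : 1 < p := by rw [hp, one_lt_div (by linarith)]; linarith
  have hpinv : p⁻¹ = ((n : ℝ) - 1) / n := by rw [hp, inv_div]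
  set A := c⁻¹ with hA
  have hApos : 0 < A := inv_pos.2 hc
  refine ⟨(A * Real.exp (-2)) ^ (n - 1) / K, by positivity,
    1 + ∑' N : ℕ, ENNReal.ofReal (2 * Real.exp 1 * Real.exp (-N)), ?_, ?_⟩
  · exact ENNReal.add_ne_top.2 ⟨ENNReal.one_ne_top,
      (Real.summable_exp_neg_nat.mul_left _).tsum_ofReal_ne_top⟩
  intro Ω u hu hcu hsub hE
  have hEtop : (∫⁻ x, ‖fderiv ℝ u x‖ₑ ^ n) ≠ ⊤ := ne_top_of_le_ne_top ENNReal.ofReal_ne_top hE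
  have hKE : K * (∫⁻ x, ‖fderiv ℝ u x‖ₑ ^ n).toReal ≤ (A * Real.exp (-2)) ^ (n - 1) := by
    have := ENNReal.toReal_le_of_le_ofReal (by positivity) hE
    rw [le_div_iff₀ hK] at this
    linarith
  -- The same tail bound holds for `u` and for `-u`.
  have htail : ∀ v : EuclideanSpace ℝ (Fin n) → ℝ, ContDiff ℝ 1 v → HasCompactSupport v →
      tsupport v ⊆ Ω → (∀ x, ‖fderiv ℝ v x‖ₑ = ‖fderiv ℝ u x‖ₑ) → ∀ N : ℕ,
      volume (v ⁻¹' Ioi ((A * N) ^ p⁻¹)) ≤ ENNReal.ofReal (Real.exp (-2 * N)) * volume Ω := by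
    intro v hv hcv hvsub hvu N
    have hpos : ∀ r : ℝ, 0 ≤ r → v ⁻¹' Ioi r ⊆ tsupport v := by
      intro r hr x hx
      have : r < v x := hx
      exact subset_tsupport _ (by simp only [Function.mem_support]; linarith)
    have hfin : ∀ r : ℝ, 0 ≤ r → volume (v ⁻¹' Ioi r) ≠ ⊤ := fun r hr =>
      ((measure_mono (hpos r hr)).trans_lt hcv.isCompact.measure_lt_top).ne
    have := hdecay v hv hcv (by simpa only [hvu] using hEtop) A hApos
      (by simpa only [hvu] using hKE) N
    rw [← hpinv] at this
    have h2 := ENNReal.ofReal_le_ofReal this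
    rw [ENNReal.ofReal_mul (Real.exp_pos _).le, ofReal_measureReal (hfin _ (by positivity)),
      ofReal_measureReal (hfin 0 le_rfl)] at h2
    refine h2.trans ?_
    gcongr
    exact (hpos 0 le_rfl).trans hvsub
  have hu1 := htail u hu hcu hsub fun _ => rfl
  have hu2 := htail (fun x => -u x) hu.neg
    (by
      have := hcu.comp_left (g := fun y : ℝ => -y) (by simp)
      exact this)
    (by
      have : tsupport (fun x => -u x) = tsupport u := by simp [tsupport]
      rw [this]
      exact hsub)
    fun x => by rw [fderiv_fun_neg, enorm_neg]
  have hmeas : ∀ N : ℕ, MeasurableSet (u ⁻¹' Ioi ((A * N) ^ p⁻¹)) := fun N =>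
    hu.continuous.measurable measurableSet_Ioi
  have hmeas2 : ∀ N : ℕ, MeasurableSet ((fun x => -u x) ⁻¹' Ioi ((A * N) ^ p⁻¹)) := fun N =>
    hu.continuous.neg.measurable measurableSet_Ioi
  have hcA : c = A⁻¹ := by rw [hA, inv_inv]
  calc ∫⁻ x in Ω, ENNReal.ofReal (Real.exp (c * |u x| ^ p))
      ≤ ∫⁻ x in Ω, (1 + ∑' N : ℕ, ENNReal.ofReal (Real.exp (N + 1)) *
          ((u ⁻¹' Ioi ((A * N) ^ p⁻¹)).indicator 1 x +
            ((fun x => -u x) ⁻¹' Ioi ((A * N) ^ p⁻¹)).indicator 1 x)) := by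
        refine lintegral_mono fun x => ?_
        rw [hcA]
        exact ofReal_exp_le_one_add_tsum hp1 hApos (u x)
    _ = volume Ω + ∑' N : ℕ, ENNReal.ofReal (Real.exp (N + 1)) *
          (volume.restrict Ω (u ⁻¹' Ioi ((A * N) ^ p⁻¹)) +
            volume.restrict Ω ((fun x => -u x) ⁻¹' Ioi ((A * N) ^ p⁻¹))) := by
        rw [lintegral_add_left measurable_const, lintegral_tsum]
        · congr 1
          · simp
          · refine tsum_congr fun N => ?_
            rw [lintegral_const_mul' _ _ ENNReal.ofReal_ne_top,
              lintegral_add_left (measurable_one.indicator (hmeas N)),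
              lintegral_indicator_one (hmeas N), lintegral_indicator_one (hmeas2 N)]
        · intro N
          exact (((measurable_one.indicator (hmeas N)).add
            (measurable_one.indicator (hmeas2 N))).const_mul _).aemeasurable
    _ ≤ volume Ω + ∑' N : ℕ, ENNReal.ofReal (2 * Real.exp 1 * Real.exp (-N)) * volume Ω := by
        refine add_le_add le_rfl (ENNReal.tsum_le_tsum fun N => ?_)
        calc _ ≤ ENNReal.ofReal (Real.exp (N + 1)) *
              (ENNReal.ofReal (Real.exp (-2 * N)) * volume Ω +
                ENNReal.ofReal (Real.exp (-2 * N)) * volume Ω) := by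
              refine mul_le_mul_right (add_le_add ?_ ?_) _
              · exact (Measure.restrict_apply_le _ _).trans (hu1 N)
              · exact (Measure.restrict_apply_le _ _).trans (hu2 N)
          _ = ENNReal.ofReal (2 * Real.exp 1 * Real.exp (-N)) * volume Ω := by
              rw [← add_mul, ← mul_assoc, ← ENNReal.ofReal_add (by positivity) (by positivity),
                ← ENNReal.ofReal_mul (by positivity), ← two_mul, mul_left_comm, ← Real.exp_add,
                mul_assoc, ← Real.exp_add]
              ring_nf
    _ = _ := by rw [ENNReal.tsum_mul_right, add_mul, one_mul]

/-! ### Trudinger's theorem on `W₀^{1,n}(Ω)` -/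

lemma enorm_pow_eq_lintegral {α E : Type*} [MeasurableSpace α] [NormedAddCommGroup E]
    {μ : Measure α} {n : ℕ} [Fact (2 ≤ n)] (f : Lp E (n : ℝ≥0∞) μ) :
    ‖f‖ₑ ^ n = ∫⁻ x, ‖f x‖ₑ ^ n ∂μ := by
  have hn : n ≠ 0 := by have := Fact.out (p := 2 ≤ n); omega
  rw [Lp.enorm_def]
  have := eLpNorm_nnreal_pow_eq_lintegral (μ := μ) (f := f) (p := (n : NNReal)) (by simpa using hn)
  simpa using this

/-- Trudinger's inequality for the elements of `W₀^{1,n}(Ω)` of small norm, from test functions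
by Fatou's lemma. -/
lemma exists_lintegral_exp_le_of_mem {n : ℕ} [Fact (2 ≤ n)] {c : ℝ} (hc : 0 < c) :
    ∃ δ : ℝ, 0 < δ ∧ ∃ B : ℝ≥0∞, B ≠ ⊤ ∧
      ∀ (Ω : Set (EuclideanSpace ℝ (Fin n))), IsOpen Ω →
        ∀ v ∈ SobolevZero Ω (n : ℝ≥0∞), ‖v.2‖ < δ →
        ∫⁻ x in Ω, ENNReal.ofReal (Real.exp (c * |v.1 x| ^ ((n : ℝ) / (n - 1)))) ≤
          B * volume Ω := by
  have hn : 2 ≤ n := Fact.out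
  obtain ⟨ε, hε, B, hB, htest⟩ := exists_lintegral_exp_le n hn hc
  have hn0 : (n : ℝ) ≠ 0 := by positivity
  refine ⟨ε ^ (1 / (n : ℝ)), by positivity, B, hB, fun Ω hΩ v hv hvδ => ?_⟩
  have key : ∀ w ∈ testPairs Ω (n : ℝ≥0∞), ‖w.2‖ < ε ^ (1 / (n : ℝ)) →
      ∫⁻ x in Ω, ENNReal.ofReal (Real.exp (c * |w.1 x| ^ ((n : ℝ) / (n - 1)))) ≤
        B * volume Ω := by
    rintro w ⟨φ, hφ, hcφ, hsφ, h1, h2⟩ hw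
    have hE : (∫⁻ x, ‖fderiv ℝ φ x‖ₑ ^ n) ≤ ENNReal.ofReal ε := by
      calc (∫⁻ x, ‖fderiv ℝ φ x‖ₑ ^ n) = ∫⁻ x in Ω, ‖fderiv ℝ φ x‖ₑ ^ n := by
            rw [← lintegral_indicator hΩ.measurableSet]
            congr 1 with x
            rw [indicator_apply_eq_self.2]
            intro hx
            rw [← ofReal_norm, image_eq_zero_of_notMem_tsupport (f := fderiv ℝ φ)
              (fun h => hx (hsφ (tsupport_fderiv_subset ℝ h))), norm_zero, ENNReal.ofReal_zero,
              zero_pow (by omega)]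
        _ = ∫⁻ x in Ω, ‖w.2 x‖ₑ ^ n := by
            refine lintegral_congr_ae ?_
            filter_upwards [h2] with x hx
            rw [hx, gradient]
            congr 1
            rw [← ofReal_norm, ← ofReal_norm, LinearIsometryEquiv.norm_map]
        _ = ‖w.2‖ₑ ^ n := (enorm_pow_eq_lintegral _).symm
        _ ≤ ENNReal.ofReal ε := by
            rw [← ofReal_norm, ← ENNReal.ofReal_pow (norm_nonneg _)]
            refine ENNReal.ofReal_le_ofReal ?_
            calc ‖w.2‖ ^ n ≤ (ε ^ (1 / (n : ℝ))) ^ n := by gcongr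
              _ = ε := by
                rw [← Real.rpow_natCast, ← Real.rpow_mul hε.le, one_div_mul_cancel hn0,
                  Real.rpow_one]
    refine le_trans (le_of_eq ?_) (htest Ω φ (hφ.of_le (by simp)) hcφ hsφ hE)
    refine lintegral_congr_ae ?_
    filter_upwards [h1] with x hx
    rw [hx]
  obtain ⟨w, hw, hlim⟩ := mem_closure_iff_seq_limit.1 (show v ∈ closure _ from hv)
  have hev : ∀ᶠ k in atTop, ‖(w k).2‖ < ε ^ (1 / (n : ℝ)) :=
    (((continuous_snd.norm.tendsto v).comp hlim).eventually (gt_mem_nhds hvδ))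
  have hmeas := tendstoInMeasure_of_tendsto_Lp ((continuous_fst.tendsto v).comp hlim)
  obtain ⟨ns, hns, hae⟩ := hmeas.exists_seq_tendsto_ae
  have hp : 0 ≤ (n : ℝ) / (n - 1) := by
    have : (1 : ℝ) < n := by exact_mod_cast hn
    have : (0 : ℝ) < n - 1 := by linarith
    positivity
  have hcont : Continuous fun y : ℝ =>
      ENNReal.ofReal (Real.exp (c * |y| ^ ((n : ℝ) / (n - 1)))) := by
    have : Continuous fun y : ℝ => |y| ^ ((n : ℝ) / (n - 1)) :=
      continuous_abs.rpow_const fun _ => Or.inr hp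
    exact ENNReal.continuous_ofReal.comp (by fun_prop)
  calc ∫⁻ x in Ω, ENNReal.ofReal (Real.exp (c * |v.1 x| ^ ((n : ℝ) / (n - 1))))
      ≤ ∫⁻ x in Ω, liminf (fun k =>
          ENNReal.ofReal (Real.exp (c * |(w (ns k)).1 x| ^ ((n : ℝ) / (n - 1))))) atTop := by
        refine lintegral_mono_ae ?_
        filter_upwards [hae] with x hx
        exact ((hcont.tendsto _).comp hx).liminf_eq.ge
    _ ≤ liminf (fun k => ∫⁻ x in Ω,
          ENNReal.ofReal (Real.exp (c * |(w (ns k)).1 x| ^ ((n : ℝ) / (n - 1))))) atTop :=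
        lintegral_liminf_le fun k => hcont.measurable.comp (Lp.stronglyMeasurable _).measurable
    _ ≤ B * volume Ω := by
        refine liminf_le_of_frequently_le' (Eventually.frequently ?_)
        filter_upwards [hns.tendsto_atTop.eventually hev] with k hk
        exact key _ (hw _) hk

/-- Trudinger's theorem: `exp (c |u|^(n/(n-1)))` is integrable for every `u ∈ W₀^{1,n}(Ω)` and every
`c`, because `u` is a small perturbation of a bounded function. -/
lemma lintegral_exp_val_ne_top {n : ℕ} [Fact (2 ≤ n)] {Ω : Set (EuclideanSpace ℝ (Fin n))}
    (hΩ : IsOpen Ω) (hΩb : Bornology.IsBounded Ω) (u : SobolevZero Ω (n : ℝ≥0∞)) {c : ℝ}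
    (hc : 0 < c) :
    ∫⁻ x in Ω, ENNReal.ofReal (Real.exp (c * |val u x| ^ ((n : ℝ) / (n - 1)))) ≠ ⊤ := by
  have hn : 2 ≤ n := Fact.out
  have hn2 : (2 : ℝ) ≤ n := by exact_mod_cast hn
  obtain ⟨δ, hδ, B, hB, hsmall⟩ := exists_lintegral_exp_le_of_mem (n := n) (c := 4 * c)
    (by positivity)
  set p : ℝ := n / (n - 1) with hp
  have hp0 : 0 < p := div_pos (by linarith) (by linarith)
  have hp2 : p ≤ 2 := by
    rw [hp, div_le_iff₀ (by linarith)]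
    linarith
  obtain ⟨w, hw, hdist⟩ := Metric.mem_closure_iff.1 (show u.1 ∈ closure _ from u.2) δ hδ
  have hwm := hw
  obtain ⟨φ, hφ, hcφ, hsφ, h1, h2⟩ := hw
  have hv := hsmall Ω hΩ (u.1 - w)
    ((SobolevZero Ω (n : ℝ≥0∞)).sub_mem u.2 (subset_closure hwm)) (by
      refine lt_of_le_of_lt ?_ hdist
      rw [dist_eq_norm]
      exact norm_snd_le (u.1 - w))
  obtain ⟨R, hR⟩ := hcφ.exists_bound_of_continuous hφ.continuous
  have hvol : volume Ω ≠ ⊤ := hΩb.measure_lt_top.ne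
  refine ne_top_of_le_ne_top (b := ENNReal.ofReal (Real.exp (4 * c * R ^ p)) * (B * volume Ω))
    (by finiteness) ?_
  refine le_trans ?_ (mul_le_mul_right hv _)
  rw [← lintegral_const_mul' _ _ ENNReal.ofReal_ne_top]
  refine lintegral_mono_ae ?_
  filter_upwards [h1, Lp.coeFn_sub u.1.1 w.1] with x hx hsub
  have hsub' : (u.1 - w).1 x = u.1.1 x - φ x := by
    rw [← hx]
    exact hsub
  rw [← ENNReal.ofReal_mul (Real.exp_pos _).le, ← Real.exp_add, hsub']
  refine ENNReal.ofReal_le_ofReal (Real.exp_le_exp.2 ?_)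
  have hφR : |φ x| ≤ R := hR x
  set y := u.1.1 x - φ x with hy
  have hval : |val u x| ≤ 2 * max R |y| := by
    have : val u x = φ x + y := by rw [hy]; simp [val]
    rw [this]
    have := abs_add_le (φ x) y
    have := le_max_left R |y|
    have := le_max_right R |y|
    linarith
  have hR0 : 0 ≤ R := (abs_nonneg _).trans hφR
  have hmax : (max R |y|) ^ p ≤ R ^ p + |y| ^ p := by
    have := Real.rpow_nonneg hR0 p
    have := Real.rpow_nonneg (abs_nonneg y) p
    rcases max_choice R |y| with h | h <;> rw [h] <;> linarith
  -- The factor `4` is `2 ^ 2`, an upper bound for `2 ^ (n / (n - 1))`.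
  have h4 : |val u x| ^ p ≤ 4 * (R ^ p + |y| ^ p) := by
    calc |val u x| ^ p ≤ (2 * max R |y|) ^ p := by gcongr
      _ = 2 ^ p * (max R |y|) ^ p := Real.mul_rpow (by norm_num) (by positivity)
      _ ≤ 2 ^ (2 : ℝ) * (R ^ p + |y| ^ p) := by
        gcongr
        norm_num
      _ = _ := by norm_num
  have := mul_le_mul_of_nonneg_left h4 hc.le
  linarith

lemma aestronglyMeasurable_val {n : ℕ} [Fact (2 ≤ n)] {Ω : Set (EuclideanSpace ℝ (Fin n))}
    (u : SobolevZero Ω (n : ℝ≥0∞)) : AEStronglyMeasurable (val u) (volume.restrict Ω) :=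
  Lp.aestronglyMeasurable u.1.1

lemma integrable_exp_val {n : ℕ} [Fact (2 ≤ n)] {Ω : Set (EuclideanSpace ℝ (Fin n))}
    (hΩ : IsOpen Ω) (hΩb : Bornology.IsBounded Ω) (u : SobolevZero Ω (n : ℝ≥0∞)) {c : ℝ}
    (hc : 0 < c) :
    Integrable (fun x => Real.exp (c * |val u x| ^ ((n : ℝ) / (n - 1)))) (volume.restrict Ω) := by
  have hp : 0 ≤ (n : ℝ) / (n - 1) := by
    have : (2 : ℝ) ≤ n := by exact_mod_cast (Fact.out : 2 ≤ n)
    exact div_nonneg (by linarith) (by linarith)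
  have hcont : Continuous fun y : ℝ => Real.exp (c * |y| ^ ((n : ℝ) / (n - 1))) := by
    have : Continuous fun y : ℝ => |y| ^ ((n : ℝ) / (n - 1)) :=
      continuous_abs.rpow_const fun _ => Or.inr hp
    fun_prop
  exact (lintegral_ofReal_ne_top_iff_integrable
    (hcont.comp_aestronglyMeasurable (aestronglyMeasurable_val u))
    (Eventually.of_forall fun x => (Real.exp_pos _).le)).1 (lintegral_exp_val_ne_top hΩ hΩb u hc)

/-! ### Pointwise properties of the nonlinearity -/

lemma M_eq (a b t : ℝ) : M a b t = a * t ^ 2 / 2 + b * t := by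
  simp only [M, m]
  rw [intervalIntegral.integral_add ((by fun_prop : Continuous _).intervalIntegrable _ _)
      ((by fun_prop : Continuous _).intervalIntegrable _ _),
    intervalIntegral.integral_const_mul, integral_id, intervalIntegral.integral_const]
  simp
  ring

lemma continuous_g {p β : ℝ} (hp : 0 < p) (hβ : 0 < β) : Continuous (g p β) := by
  have h1 : Continuous fun s : ℝ => |s| ^ p := continuous_abs.rpow_const fun _ => Or.inr hp.le
  have h2 : Continuous fun s : ℝ => |s| ^ β := continuous_abs.rpow_const fun _ => Or.inr hβ.le
  unfold g
  fun_prop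

lemma hasDerivAt_G {p β : ℝ} (hp : 0 < p) (hβ : 0 < β) (t : ℝ) :
    HasDerivAt (G p β) (g p β t) t :=
  ((continuous_g hp hβ).integral_hasStrictDerivAt 0 t).hasDerivAt

lemma continuous_G {p β : ℝ} (hp : 0 < p) (hβ : 0 < β) : Continuous (G p β) :=
  continuous_iff_continuousAt.2 fun t => (hasDerivAt_G hp hβ t).continuousAt

lemma G_abs (p β s : ℝ) : G p β |s| = G p β s := by
  rcases abs_choice s with h | h
  · rw [h]
  · rw [h, G, G]
    have h1 := intervalIntegral.integral_comp_neg (a := 0) (b := s) (fun x => g p β x)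
    have h2 : ∀ x, g p β (-x) = -g p β x := fun x => by simp [g]
    simp only [h2, intervalIntegral.integral_neg, neg_zero] at h1
    rw [intervalIntegral.integral_symm (-s) 0, ← h1, neg_neg]

lemma abs_g {p : ℝ} (hp : 0 < p) (β s : ℝ) :
    |g p β s| = |s| ^ (p + 1) * Real.exp (|s| ^ β) := by
  rw [g, abs_mul, abs_mul, Real.abs_exp, abs_of_nonneg (Real.rpow_nonneg (abs_nonneg s) p),
    Real.rpow_add_one' (abs_nonneg s) (by linarith)]
  ring

lemma g_mul_self {p : ℝ} (hp : 0 < p) (β s : ℝ) :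
    g p β s * s = |s| ^ (p + 2) * Real.exp (|s| ^ β) := by
  have h2 : |s| ^ (p + 2) = |s| ^ p * |s| ^ 2 := by
    rw [← Real.rpow_natCast, ← Real.rpow_add' (abs_nonneg s)]
    · norm_num
    · push_cast
      linarith
  rw [g, h2, sq_abs]
  ring

lemma G_nonneg (p β s : ℝ) : 0 ≤ G p β s := by
  rw [← G_abs]
  refine intervalIntegral.integral_nonneg (abs_nonneg s) fun x hx => ?_
  have := hx.1
  unfold g
  positivity

/-- The gap in the Ambrosetti–Rabinowitz inequality `(p + 2) G(s) ≤ g(s) s`, which comes from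
integrating `G` by parts. -/
lemma G_add_rpow_le {p β : ℝ} (hp : 0 < p) (hβ : 0 < β) (s : ℝ) :
    G p β s + β / ((p + 2) * (p + 2 + β)) * |s| ^ (p + 2 + β) ≤ g p β s * s / (p + 2) := by
  rw [g_mul_self hp, ← G_abs]
  generalize hr : |s| = r
  have hr0 : 0 ≤ r := hr ▸ abs_nonneg s
  set κ := β / ((p + 2) * (p + 2 + β)) with hκ
  set F : ℝ → ℝ := fun x =>
    x ^ (p + 2) * Real.exp (x ^ β) / (p + 2) - κ * x ^ (p + 2 + β) - G p β x with hF
  have hcont : Continuous F := by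
    have h1 : Continuous fun x : ℝ => x ^ (p + 2) :=
      Real.continuous_rpow_const (by linarith)
    have h2 : Continuous fun x : ℝ => x ^ β := Real.continuous_rpow_const hβ.le
    have h3 : Continuous fun x : ℝ => x ^ (p + 2 + β) := Real.continuous_rpow_const (by linarith)
    have h4 := continuous_G hp hβ
    fun_prop
  have hderiv : ∀ x : ℝ, 0 < x →
      HasDerivAt F (β / (p + 2) * (x ^ (p + 1 + β) * (Real.exp (x ^ β) - 1))) x := by
    intro x hx
    have h1 := Real.hasDerivAt_rpow_const (x := x) (p := p + 2) (Or.inl hx.ne')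
    have h2 := (Real.hasDerivAt_rpow_const (x := x) (p := β) (Or.inl hx.ne')).exp
    have h3 := Real.hasDerivAt_rpow_const (x := x) (p := p + 2 + β) (Or.inl hx.ne')
    have h := (((h1.mul h2).div_const (p + 2)).sub (h3.const_mul κ)).sub (hasDerivAt_G hp hβ x)
    refine h.congr_deriv ?_
    have e1 : x ^ (p + 2 - 1) = x * x ^ p := by
      rw [mul_comm, ← Real.rpow_add_one hx.ne']
      ring_nf
    have e2 : x ^ (p + 2) = x ^ p * x ^ 2 := by
      rw [← Real.rpow_natCast, ← Real.rpow_add hx]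
      norm_num
    have e3 : x ^ (p + 2 + β - 1) = x * x ^ p * x ^ β := by
      rw [mul_comm x, ← Real.rpow_add_one hx.ne', ← Real.rpow_add hx]
      ring_nf
    have e4 : x ^ (p + 1 + β) = x * x ^ p * x ^ β := by
      rw [mul_comm x, ← Real.rpow_add_one hx.ne', ← Real.rpow_add hx]
    have e5 : x ^ (β - 1) = x ^ β / x := Real.rpow_sub_one hx.ne' β
    have hp2 : p + 2 ≠ 0 := by linarith
    have hpb : p + 2 + β ≠ 0 := by linarith
    rw [e1, e2, e3, e4, e5, g, abs_of_pos hx, hκ]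
    field_simp
    ring
  have hmono : MonotoneOn F (Ici 0) := by
    refine monotoneOn_of_deriv_nonneg (convex_Ici 0) hcont.continuousOn ?_ ?_
    · intro x hx
      rw [interior_Ici] at hx
      exact (hderiv x hx).differentiableAt.differentiableWithinAt
    · intro x hx
      rw [interior_Ici] at hx
      have hx' : 0 < x := hx
      rw [(hderiv x hx').deriv]
      have : 1 ≤ Real.exp (x ^ β) := Real.one_le_exp (by positivity)
      have : 0 ≤ Real.exp (x ^ β) - 1 := by linarith
      positivity
  have h0 : F 0 = 0 := by
    simp [hF, G, Real.zero_rpow (show p + 2 ≠ 0 by linarith),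
      Real.zero_rpow (show p + 2 + β ≠ 0 by linarith)]
  have := hmono (mem_Ici.2 le_rfl) (mem_Ici.2 hr0) hr0
  rw [h0] at this
  simp only [hF] at this
  linarith

/-- Every admissible growth is dominated by the critical one: `|s|^t ≤ 1 + |s|^P` for `0 ≤ t ≤ P`, and
powers are bounded by exponentials. -/
lemma abs_rpow_mul_exp_le {r d β P : ℝ} (hr : 0 ≤ r) (hd : 0 ≤ d) (hβ : 0 ≤ β) (hβP : β ≤ P)
    (hP : 1 ≤ P) (s : ℝ) :
    |s| ^ r * Real.exp (d * |s| ^ β) ≤ Real.exp (r + d) * Real.exp ((r + d) * |s| ^ P) := by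
  have hs := abs_nonneg s
  have hpow : ∀ t : ℝ, 0 ≤ t → t ≤ P → |s| ^ t ≤ 1 + |s| ^ P := by
    intro t ht htP
    rcases le_total |s| 1 with h | h
    · have := Real.rpow_le_one hs h ht
      have := Real.rpow_nonneg hs P
      linarith
    · have := Real.rpow_le_rpow_of_exponent_le h htP
      linarith
  have h1 : |s| ^ r ≤ Real.exp (r * |s|) := by
    rw [mul_comm, Real.exp_mul]
    refine Real.rpow_le_rpow hs ?_ hr
    have := Real.add_one_le_exp |s|
    linarith
  have h2 := hpow 1 zero_le_one hP
  rw [Real.rpow_one] at h2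
  calc |s| ^ r * Real.exp (d * |s| ^ β)
      ≤ Real.exp (r * (1 + |s| ^ P)) * Real.exp (d * (1 + |s| ^ P)) := by
        gcongr
        · exact h1.trans (Real.exp_le_exp.2 (mul_le_mul_of_nonneg_left h2 hr))
        · exact hpow β hβ hβP
    _ = _ := by
        rw [← Real.exp_add, ← Real.exp_add]
        ring_nf

/-- Young's inequality with conjugate exponents `k`, `k / (k - 1)` for `k = (p + 2 + β) / (q + 1)`
and a constant that does not depend on `β > 0`. -/
lemma exists_young {p q κ : ℝ} (hq : 0 < q) (hqp : q < p + 1) (hκ : 0 < κ) (hκ1 : κ ≤ 1) :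
    ∃ C : ℝ, 0 < C ∧ ∀ β : ℝ, 0 < β → ∀ k : ℝ, k = (p + 2 + β) / (q + 1) →
      ∀ x y : ℝ, 0 ≤ x → 0 ≤ y →
        y * x ^ (q + 1) ≤ κ * x ^ (p + 2 + β) + C * y ^ (k / (k - 1)) := by
  have hq1 : 0 < q + 1 := by linarith
  set k₀ := (p + 2) / (q + 1) with hk₀
  have hk₀1 : 1 < k₀ := by
    rw [hk₀, one_lt_div hq1]
    linarith
  have hκinv : 1 ≤ κ⁻¹ := (one_le_inv₀ hκ).2 hκ1
  refine ⟨κ⁻¹ ^ (1 / (k₀ - 1)), by positivity, fun β hβ k hk x y hx hy => ?_⟩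
  have hkk : k₀ ≤ k := by
    rw [hk, hk₀]
    exact div_le_div_of_nonneg_right (by linarith) hq1.le
  have hk1 : 0 < k - 1 := by linarith
  set X := x ^ (q + 1) with hX
  have hX0 : 0 ≤ X := by positivity
  have hXk : x ^ (p + 2 + β) = X ^ (k - 1) * X := by
    rw [← Real.rpow_add_one' hX0 (by linarith), hX, ← Real.rpow_mul hx, hk]
    congr 1
    field_simp
    ring
  rw [hXk]
  -- Either the first term absorbs the product, or `X` is bounded by a power of `y`; as `κ⁻¹ ≥ 1`, the
  -- resulting power of `κ⁻¹` is largest at the smallest exponent `k₀`.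
  rcases le_or_gt y (κ * X ^ (k - 1)) with h | h
  · have h1 : y * X ≤ κ * X ^ (k - 1) * X := mul_le_mul_of_nonneg_right h hX0
    have : 0 ≤ κ⁻¹ ^ (1 / (k₀ - 1)) * y ^ (k / (k - 1)) := by positivity
    linarith
  · have hypos : 0 < y := lt_of_le_of_lt (by positivity) h
    have h1 : X ≤ (κ⁻¹ * y) ^ (1 / (k - 1)) := by
      rw [one_div, Real.le_rpow_inv_iff_of_pos hX0 (by positivity) hk1, ← div_eq_inv_mul,
        le_div_iff₀ hκ]
      linarith
    have h2 : (κ⁻¹ * y) ^ (1 / (k - 1)) ≤ κ⁻¹ ^ (1 / (k₀ - 1)) * y ^ (1 / (k - 1)) := by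
      rw [Real.mul_rpow (by positivity) hy]
      gcongr
    have h3 : y * y ^ (1 / (k - 1)) = y ^ (k / (k - 1)) := by
      rw [mul_comm, ← Real.rpow_add_one hypos.ne']
      congr 1
      field_simp
      ring
    have h4 : y * X ≤ y * (κ⁻¹ ^ (1 / (k₀ - 1)) * y ^ (1 / (k - 1))) :=
      mul_le_mul_of_nonneg_left (h1.trans h2) hy
    rw [mul_left_comm, h3] at h4
    have : 0 ≤ κ * (X ^ (k - 1) * X) := by positivity
    linarith

/-! ### Scaling, integrability and derivative of the energy terms -/

section

variable {n : ℕ} [Fact (2 ≤ n)] {Ω : Set (EuclideanSpace ℝ (Fin n))}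

lemma gradNorm_pow (u : SobolevZero Ω (n : ℝ≥0∞)) :
    gradNorm u ^ n = ∫ x in Ω, ‖grad u x‖ ^ n := by
  have hn : n ≠ 0 := by have := Fact.out (p := 2 ≤ n); omega
  rw [gradNorm, one_div]
  exact Real.rpow_inv_natCast_pow (integral_nonneg fun x => by positivity) hn

lemma val_smul (t : ℝ) (u : SobolevZero Ω (n : ℝ≥0∞)) :
    val (t • u) =ᵐ[volume.restrict Ω] fun x => t * val u x :=
  Lp.coeFn_smul t u.1.1

lemma gradNorm_smul_pow (t : ℝ) (u : SobolevZero Ω (n : ℝ≥0∞)) :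
    gradNorm (t • u) ^ n = |t| ^ n * gradNorm u ^ n := by
  rw [gradNorm_pow, gradNorm_pow, ← integral_const_mul]
  refine integral_congr_ae ?_
  filter_upwards [Lp.coeFn_smul t u.1.2] with x hx
  have : grad (t • u) x = t • grad u x := hx
  rw [this, norm_smul, mul_pow, Real.norm_eq_abs]

lemma integrable_rpow_mul_exp_val {n : ℕ} [Fact (2 ≤ n)] {Ω : Set (EuclideanSpace ℝ (Fin n))}
    (hΩ : IsOpen Ω) (hΩb : Bornology.IsBounded Ω) (u : SobolevZero Ω (n : ℝ≥0∞)) {r d β : ℝ}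
    (hr : 0 < r) (hd : 0 ≤ d) (hβ : 0 ≤ β) (hβn : β ≤ (n : ℝ) / (n - 1)) :
    Integrable (fun x => |val u x| ^ r * Real.exp (d * |val u x| ^ β)) (volume.restrict Ω) := by
  have hn2 : (2 : ℝ) ≤ n := by exact_mod_cast (Fact.out : 2 ≤ n)
  have hP : 1 ≤ (n : ℝ) / (n - 1) := by
    rw [one_le_div (by linarith)]
    linarith
  have hcont : Continuous fun y : ℝ => |y| ^ r * Real.exp (d * |y| ^ β) := by
    have h1 : Continuous fun y : ℝ => |y| ^ r := continuous_abs.rpow_const fun _ => Or.inr hr.le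
    have h2 : Continuous fun y : ℝ => |y| ^ β := continuous_abs.rpow_const fun _ => Or.inr hβ
    fun_prop
  refine ((integrable_exp_val hΩ hΩb u (c := r + d) (by linarith)).const_mul
    (Real.exp (r + d))).mono' (hcont.comp_aestronglyMeasurable (aestronglyMeasurable_val u)) ?_
  refine Eventually.of_forall fun x => ?_
  rw [Real.norm_of_nonneg (by positivity)]
  exact abs_rpow_mul_exp_le hr.le hd hβ hβn hP _

lemma integrable_g_mul_val {p β : ℝ} (hp : 0 < p) (hβ : 0 < β) (hβn : β ≤ (n : ℝ) / (n - 1))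
    (hΩ : IsOpen Ω) (hΩb : Bornology.IsBounded Ω) (u : SobolevZero Ω (n : ℝ≥0∞)) :
    Integrable (fun x => g p β (val u x) * val u x) (volume.restrict Ω) := by
  have := integrable_rpow_mul_exp_val hΩ hΩb u (r := p + 2) (d := 1) (by linarith) zero_le_one
    hβ.le hβn
  simpa only [g_mul_self hp, one_mul] using this

lemma integrable_G_val {p β : ℝ} (hp : 0 < p) (hβ : 0 < β) (hβn : β ≤ (n : ℝ) / (n - 1))
    (hΩ : IsOpen Ω) (hΩb : Bornology.IsBounded Ω) (u : SobolevZero Ω (n : ℝ≥0∞)) :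
    Integrable (fun x => G p β (val u x)) (volume.restrict Ω) := by
  refine ((integrable_g_mul_val hp hβ hβn hΩ hΩb u).div_const (p + 2)).mono'
    ((continuous_G hp hβ).comp_aestronglyMeasurable (aestronglyMeasurable_val u))
    (Eventually.of_forall fun x => ?_)
  rw [Real.norm_of_nonneg (G_nonneg _ _ _)]
  have := G_add_rpow_le hp hβ (val u x)
  have : 0 ≤ β / ((p + 2) * (p + 2 + β)) * |val u x| ^ (p + 2 + β) := by positivity
  linarith

/-- Differentiation under the integral sign at `t = 1`; on `0 < t < 2` the derivative of the
integrand is dominated by `2^(p+1) |u|^(p+2) exp (2^β |u|^β)`, integrable by Trudinger's theorem. -/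
lemma hasDerivAt_integral_G {p β : ℝ} (hp : 0 < p) (hβ : 0 < β) (hβn : β ≤ (n : ℝ) / (n - 1))
    (hΩ : IsOpen Ω) (hΩb : Bornology.IsBounded Ω) (u : SobolevZero Ω (n : ℝ≥0∞)) :
    HasDerivAt (fun t : ℝ => ∫ x in Ω, G p β (t * val u x))
      (∫ x in Ω, g p β (val u x) * val u x) 1 := by
  have hmeas := aestronglyMeasurable_val u
  have hbound := (integrable_rpow_mul_exp_val hΩ hΩb u (r := p + 2) (d := 2 ^ β) (by linarith)
    (by positivity) hβ.le hβn).const_mul (2 ^ (p + 1))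
  have h := (hasDerivAt_integral_of_dominated_loc_of_deriv_le
    (μ := volume.restrict Ω) (F := fun t x => G p β (t * val u x))
    (F' := fun t x => g p β (t * val u x) * val u x) (x₀ := (1 : ℝ)) (s := Ioo 0 2)
    (Ioo_mem_nhds zero_lt_one one_lt_two)
    (Eventually.of_forall fun t =>
      (continuous_G hp hβ).comp_aestronglyMeasurable (hmeas.const_mul t))
    (by simpa only [one_mul] using integrable_G_val hp hβ hβn hΩ hΩb u)
    (by simpa only [one_mul] using
      (integrable_g_mul_val hp hβ hβn hΩ hΩb u).aestronglyMeasurable)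
    (Eventually.of_forall fun x t ht => ?_) hbound
    (Eventually.of_forall fun x t _ => ?_)).2
  · simpa only [one_mul] using h
  · have hs := abs_nonneg (val u x)
    have h1 : |t * val u x| ≤ 2 * |val u x| := by
      rw [abs_mul, abs_of_pos ht.1]
      gcongr
      exact ht.2.le
    have h2 : |val u x| ^ (p + 2) = |val u x| ^ (p + 1) * |val u x| := by
      rw [← Real.rpow_add_one' hs (by linarith)]
      ring_nf
    rw [norm_mul, Real.norm_eq_abs, Real.norm_eq_abs, abs_g hp]
    calc |t * val u x| ^ (p + 1) * Real.exp (|t * val u x| ^ β) * |val u x|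
        ≤ (2 * |val u x|) ^ (p + 1) * Real.exp ((2 * |val u x|) ^ β) * |val u x| := by gcongr
      _ = _ := by
        rw [Real.mul_rpow zero_le_two hs, Real.mul_rpow zero_le_two hs, h2]
        ring
  · have := (hasDerivAt_G hp hβ (t * val u x)).comp t ((hasDerivAt_id t).mul_const (val u x))
    refine this.congr_deriv ?_
    simp

lemma fiber_eq {p q β a b lam t : ℝ} (ht : 0 < t) (h : EuclideanSpace ℝ (Fin n) → ℝ)
    (u : SobolevZero Ω (n : ℝ≥0∞)) :
    fiber p q β a b lam h u t =
      1 / (n : ℝ) * (a * (t ^ n * gradNorm u ^ n) ^ 2 / 2 + b * (t ^ n * gradNorm u ^ n))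
        - lam / (q + 1) * (t ^ (q + 1) * ∫ x in Ω, h x * |val u x| ^ (q + 1))
        - ∫ x in Ω, G p β (t * val u x) := by
  have hval := val_smul t u
  have h1 : (∫ x in Ω, h x * |val (t • u) x| ^ (q + 1)) =
      t ^ (q + 1) * ∫ x in Ω, h x * |val u x| ^ (q + 1) := by
    rw [← integral_const_mul]
    refine integral_congr_ae ?_
    filter_upwards [hval] with x hx
    rw [hx, abs_mul, abs_of_pos ht, Real.mul_rpow ht.le (abs_nonneg _)]
    ring
  have h2 : (∫ x in Ω, G p β (val (t • u) x)) = ∫ x in Ω, G p β (t * val u x) := by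
    refine integral_congr_ae ?_
    filter_upwards [hval] with x hx
    rw [hx]
  rw [fiber, J, M_eq, gradNorm_smul_pow, abs_of_pos ht, h1, h2]

/-! ### Energy on the Nehari manifold -/

/-- The equation `⟨J'(u), u⟩ = 0` of the Nehari manifold, written out. -/
lemma nehari_eq {p q β a b lam : ℝ} (hp : 0 < p) (hq : 0 < q) (hβ : 0 < β)
    (hβn : β ≤ (n : ℝ) / (n - 1)) (hΩ : IsOpen Ω) (hΩb : Bornology.IsBounded Ω)
    {h : EuclideanSpace ℝ (Fin n) → ℝ} {u : SobolevZero Ω (n : ℝ≥0∞)}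
    (hu : u ∈ nehari Ω p q β a b lam h) :
    a * (gradNorm u ^ n) ^ 2 + b * gradNorm u ^ n =
      lam * (∫ x in Ω, h x * |val u x| ^ (q + 1)) + ∫ x in Ω, g p β (val u x) * val u x := by
  have hn : (n : ℝ) ≠ 0 := by
    have := Fact.out (p := 2 ≤ n)
    positivity
  set N := gradNorm u ^ n with hN
  set A := ∫ x in Ω, h x * |val u x| ^ (q + 1) with hA
  have h1 : HasDerivAt (fun t : ℝ => t ^ n * N) (n * N) 1 := by
    simpa using (hasDerivAt_pow n (1 : ℝ)).mul_const N
  have h2 : HasDerivAt (fun t : ℝ => t ^ (q + 1) * A) ((q + 1) * A) 1 := by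
    simpa using (Real.hasDerivAt_rpow_const (x := 1) (p := q + 1) (Or.inl one_ne_zero)).mul_const A
  have h3 := hasDerivAt_integral_G hp hβ hβn hΩ hΩb u
  have h4 := ((((((h1.pow 2).const_mul a).div_const 2).add (h1.const_mul b)).const_mul
    (1 / (n : ℝ))).sub (h2.const_mul (lam / (q + 1)))).sub h3
  have h5 : HasDerivAt (fiber p q β a b lam h u) _ 1 := h4.congr_of_eventuallyEq (by
    filter_upwards [Ioi_mem_nhds (zero_lt_one' ℝ)] with t ht
    exact fiber_eq ht h u)
  have h6 := h5.unique hu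
  simp only [one_pow, one_mul] at h6
  have hq1 : q + 1 ≠ 0 := by linarith
  norm_num at h6
  field_simp at h6
  linarith

/-- The energy estimate on the Nehari manifold: subtracting `1 / (p + 2)` times the Nehari equation
makes the gradient terms positive and leaves a multiple of `|u|^(p+2+β)`, which absorbs the
`h`-term by Young's inequality. -/
lemma exists_le_J_of_mem_nehari {p q : ℝ} (hq : 0 < q) (hqn : q < (n : ℝ) - 1)
    (hp : 2 * (n : ℝ) - 1 < p + 1) :
    ∃ C : ℝ, 0 < C ∧ ∀ β : ℝ, 1 < β → β ≤ (n : ℝ) / ((n : ℝ) - 1) →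
      ∀ Ω : Set (EuclideanSpace ℝ (Fin n)), IsOpen Ω → Bornology.IsBounded Ω →
      ∀ h : EuclideanSpace ℝ (Fin n) → ℝ,
        MemLp h (ENNReal.ofReal ((n : ℝ) / ((n : ℝ) - q - 1))) (volume.restrict Ω) →
      ∀ a b lam : ℝ, 0 < a → 0 < lam → ∀ k : ℝ, k = (p + 2 + β) / (q + 1) →
      ∀ u ∈ nehari Ω p q β a b lam h,
        (1 / (n : ℝ) - 1 / (p + 2)) * b * gradNorm u ^ n
            - C * (∫ x in Ω, |h x| ^ (k / (k - 1))) * lam ^ (k / (k - 1)) ≤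
          J p q β a b lam h u := by
  have hn2 : (2 : ℝ) ≤ n := by exact_mod_cast (Fact.out : 2 ≤ n)
  have hp0 : 0 < p := by linarith
  set κ : ℝ := 1 / ((p + 2) * (p + 4)) with hκ
  obtain ⟨C, hC, hyoung⟩ := exists_young (p := p) (q := q) (κ := κ) hq (by linarith)
    (by positivity) (by
      rw [hκ, div_le_one (by positivity)]
      nlinarith)
  refine ⟨C, hC, fun β hβ1 hβn Ω hΩ hΩb h hh a b lam ha hlam k hk u hu => ?_⟩
  have hβ : 0 < β := by linarith
  have hβ2 : β ≤ 2 := by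
    refine hβn.trans ?_
    rw [div_le_iff₀ (by linarith)]
    linarith
  have hq1 : 0 < q + 1 := by linarith
  have hk1 : 1 < k := by
    rw [hk, one_lt_div hq1]
    linarith
  have hk' : 0 < k / (k - 1) := div_pos (by linarith) (by linarith)
  have : IsFiniteMeasure (volume.restrict Ω) := ⟨by
    rw [Measure.restrict_apply_univ]
    exact hΩb.measure_lt_top⟩
  -- Since `Ω` is bounded, `L^γ(Ω)` is contained in `L^(k/(k-1))(Ω)`.
  have hhk : Integrable (fun x => |h x| ^ (k / (k - 1))) (volume.restrict Ω) := by
    have hle : k / (k - 1) ≤ (n : ℝ) / ((n : ℝ) - q - 1) := by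
      have hkn : (n : ℝ) ≤ k * (q + 1) := by
        rw [hk]
        field_simp
        linarith
      rw [div_le_div_iff₀ (by linarith) (by linarith)]
      linarith
    have := (hh.mono_exponent (ENNReal.ofReal_le_ofReal hle)).integrable_norm_rpow
      (by simpa using hk') ENNReal.ofReal_ne_top
    simpa only [ENNReal.toReal_ofReal hk'.le, Real.norm_eq_abs] using this
  have hpow : Integrable (fun x => |val u x| ^ (p + 2 + β)) (volume.restrict Ω) := by
    have := integrable_rpow_mul_exp_val hΩ hΩb u (r := p + 2 + β) (d := 0) (by linarith) le_rfl
      hβ.le hβn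
    simpa using this
  have hmul : ∀ x, (lam * |h x|) ^ (k / (k - 1)) = lam ^ (k / (k - 1)) * |h x| ^ (k / (k - 1)) :=
    fun x => Real.mul_rpow hlam.le (abs_nonneg _)
  have hpt : ∀ x, lam * |h x| * |val u x| ^ (q + 1) ≤
      κ * |val u x| ^ (p + 2 + β) + C * lam ^ (k / (k - 1)) * |h x| ^ (k / (k - 1)) := by
    intro x
    have := hyoung β hβ k hk |val u x| (lam * |h x|) (abs_nonneg _) (by positivity)
    rw [hmul] at this
    linarith
  have hhu : Integrable (fun x => lam * (h x * |val u x| ^ (q + 1))) (volume.restrict Ω) := by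
    refine ((hpow.const_mul κ).add (hhk.const_mul (C * lam ^ (k / (k - 1))))).mono' ?_
      (Eventually.of_forall fun x => ?_)
    · have hc : Continuous fun y : ℝ => |y| ^ (q + 1) :=
        continuous_abs.rpow_const fun _ => Or.inr hq1.le
      exact (hh.1.mul (hc.comp_aestronglyMeasurable (aestronglyMeasurable_val u))).const_mul lam
    · rw [norm_mul, norm_mul, Real.norm_of_nonneg hlam.le, Real.norm_eq_abs, Real.norm_eq_abs,
        abs_of_nonneg (Real.rpow_nonneg (abs_nonneg (val u x)) _), ← mul_assoc]
      exact hpt x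
  have hG := integrable_G_val hp0 hβ hβn hΩ hΩb u
  have hgu := integrable_g_mul_val hp0 hβ hβn hΩ hΩb u
  set τ : ℝ := 1 / (q + 1) - 1 / (p + 2) with hτ
  have hτ0 : 0 ≤ τ := sub_nonneg.2 (one_div_le_one_div_of_le hq1 (by linarith))
  have hτ1 : τ ≤ 1 := by
    have : 1 / (q + 1) ≤ 1 := by
      rw [div_le_one hq1]
      linarith
    have : 0 < 1 / (p + 2) := by positivity
    linarith
  have hκβ : κ ≤ β / ((p + 2) * (p + 2 + β)) := by
    rw [hκ, div_le_div_iff₀ (by positivity) (by positivity), one_mul]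
    have : p + 2 + β ≤ β * (p + 4) := by nlinarith
    calc (p + 2) * (p + 2 + β) ≤ (p + 2) * (β * (p + 4)) := by gcongr
      _ = _ := by ring
  have hint : τ * (∫ x in Ω, lam * (h x * |val u x| ^ (q + 1))) + ∫ x in Ω, G p β (val u x) ≤
      1 / (p + 2) * (∫ x in Ω, g p β (val u x) * val u x) +
        C * lam ^ (k / (k - 1)) * ∫ x in Ω, |h x| ^ (k / (k - 1)) := by
    rw [← integral_const_mul, ← integral_const_mul, ← integral_const_mul,
      ← integral_add (hhu.const_mul τ) hG, ← integral_add (hgu.const_mul _) (hhk.const_mul _)]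
    refine integral_mono ((hhu.const_mul τ).add hG) ((hgu.const_mul _).add (hhk.const_mul _))
      fun x => ?_
    have h1 := G_add_rpow_le hp0 hβ (val u x)
    have hpos : 0 ≤ |val u x| ^ (p + 2 + β) := by positivity
    have h2 := mul_le_mul_of_nonneg_right hκβ hpos
    have h3 : τ * (lam * (h x * |val u x| ^ (q + 1))) ≤ lam * |h x| * |val u x| ^ (q + 1) := by
      have e1 : lam * (h x * |val u x| ^ (q + 1)) ≤ lam * |h x| * |val u x| ^ (q + 1) := by
        rw [← mul_assoc]
        gcongr
        exact le_abs_self _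
      have e2 : 0 ≤ lam * |h x| * |val u x| ^ (q + 1) := by positivity
      nlinarith
    have h4 := hpt x
    have h5 : g p β (val u x) * val u x / (p + 2) =
      1 / (p + 2) * (g p β (val u x) * val u x) := by ring
    linarith
  have hneh := nehari_eq hp0 hq hβ hβn hΩ hΩb hu
  rw [integral_const_mul] at hint
  rw [J, M_eq]
  set N := gradNorm u ^ n with hN
  set A := ∫ x in Ω, h x * |val u x| ^ (q + 1) with hA
  set I := ∫ x in Ω, g p β (val u x) * val u x with hI
  have hIeq : I = a * N ^ 2 + b * N - lam * A := by linarith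
  have hcoef : 0 ≤ 1 / (n : ℝ) / 2 - 1 / (p + 2) := by
    rw [div_div]
    exact sub_nonneg.2 (one_div_le_one_div_of_le (by linarith) (by linarith))
  have haN : 0 ≤ (1 / (n : ℝ) / 2 - 1 / (p + 2)) * (a * N ^ 2) := by positivity
  have e3 : lam / (q + 1) * A = τ * (lam * A) + 1 / (p + 2) * (lam * A) := by
    rw [hτ]
    ring
  rw [hIeq] at hint
  rw [e3]
  linarith

end

end Kirchhoff

theorem theorem3p5 (n : ℕ) [Fact (2 ≤ n)] (p q : ℝ)
    (hq0 : 0 < q) (hqn : q < (n : ℝ) - 1) (hp : 2 * (n : ℝ) - 1 < p + 1) :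
    ∃ C : ℝ, 0 < C ∧
      ∀ (β : ℝ), 1 < β → β ≤ (n : ℝ) / ((n : ℝ) - 1) →
      ∀ (Ω : Set (EuclideanSpace ℝ (Fin n))), IsOpen Ω → Bornology.IsBounded Ω →
      ∀ (h : EuclideanSpace ℝ (Fin n) → ℝ),
        MemLp h (ENNReal.ofReal ((n : ℝ) / ((n : ℝ) - q - 1))) (volume.restrict Ω) →
        (¬ ∀ᵐ x ∂(volume.restrict Ω), h x ≤ 0) →
      ∀ (a b lam : ℝ), 0 < a → 0 < b → 0 < lam →
      ∀ (k : ℝ), k = (p + 2 + β) / (q + 1) →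
        BddBelow (Kirchhoff.J p q β a b lam h '' Kirchhoff.nehari Ω p q β a b lam h) ∧
        Tendsto (Kirchhoff.J p q β a b lam h)
          (comap Kirchhoff.gradNorm atTop ⊓ 𝓟 (Kirchhoff.nehari Ω p q β a b lam h)) atTop ∧
        -(C * (∫ x in Ω, |h x| ^ (k / (k - 1))) * lam ^ (k / (k - 1))) ≤
          Kirchhoff.theta Ω p q β a b lam h := by
  obtain ⟨C, hC, hlow⟩ := Kirchhoff.exists_le_J_of_mem_nehari hq0 hqn hp
  refine ⟨C, hC, fun β hβ1 hβn Ω hΩ hΩb h hh _ a b lam ha hb hlam k hk => ?_⟩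
  have hn2 : (2 : ℝ) ≤ n := by exact_mod_cast (Fact.out : 2 ≤ n)
  have hbound := hlow β hβ1 hβn Ω hΩ hΩb h hh a b lam ha hlam k hk
  set D := C * (∫ x in Ω, |h x| ^ (k / (k - 1))) * lam ^ (k / (k - 1)) with hD
  have hc : 0 < (1 / (n : ℝ) - 1 / (p + 2)) * b :=
    mul_pos (sub_pos.2 (one_div_lt_one_div_of_lt (by linarith) (by linarith))) hb
  have hJD : ∀ y ∈ Kirchhoff.J p q β a b lam h '' Kirchhoff.nehari Ω p q β a b lam h, -D ≤ y := by
    rintro _ ⟨u, hu, rfl⟩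
    have hN : 0 ≤ Kirchhoff.gradNorm u ^ n := by
      rw [Kirchhoff.gradNorm_pow]
      exact integral_nonneg fun x => by positivity
    have := mul_nonneg hc.le hN
    have := hbound u hu
    linarith
  refine ⟨⟨-D, hJD⟩, ?_, ?_⟩
  · have hlim : Tendsto (fun u : Kirchhoff.SobolevZero Ω (n : ℝ≥0∞) =>
        (1 / (n : ℝ) - 1 / (p + 2)) * b * Kirchhoff.gradNorm u ^ n - D)
        (comap Kirchhoff.gradNorm atTop ⊓ 𝓟 (Kirchhoff.nehari Ω p q β a b lam h)) atTop := by
      refine tendsto_atTop_add_const_right _ _ (Tendsto.const_mul_atTop hc ?_)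
      exact (tendsto_pow_atTop (by have := Fact.out (p := 2 ≤ n); omega)).comp
        (tendsto_comap.mono_left inf_le_left)
    refine tendsto_atTop_mono' _ ?_ hlim
    filter_upwards [mem_inf_of_right (mem_principal_self _)] with u hu
    exact hbound u hu
  · refine le_csInf ⟨_, mem_image_of_mem _ (show (0 : Kirchhoff.SobolevZero Ω (n : ℝ≥0∞)) ∈
      Kirchhoff.nehari Ω p q β a b lam h from ?_)⟩ hJD
    -- The manifold contains `0`, whose fibering map is constant.
    have : Kirchhoff.fiber p q β a b lam h (0 : Kirchhoff.SobolevZero Ω (n : ℝ≥0∞)) =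
        fun _ => Kirchhoff.J p q β a b lam h (0 : Kirchhoff.SobolevZero Ω (n : ℝ≥0∞)) := by
      funext t
      rw [Kirchhoff.fiber, smul_zero]
    change HasDerivAt _ _ _
    rw [this]
    exact hasDerivAt_const _ _
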